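/- Let $A$ be a unital $C^*$-algebra, and let $A''$ be its bidual von Neumann algebra: the second Banach space dual of $A$ with the Arens product $(FG)(f)=F(G\cdot f)$, where $(G\cdot f)(a)=G(f\cdot a)$ and $(f\cdot a)(b)=f(ab)$, and the involution $F^*(f)=\overline{F(f^*)}$, where $f^*(a)=\overline{f(a^*)}$ (for $F,G\in A''$, $f\in A'$, $a,b\in A$). Regard $A$ as a subalgebra of $A''$ via the canonical embedding $a\mapsto(f\mapsto f(a))$. A minimal projection of $A''$ is a self-adjoint idempotent $e\in A''$ such that $eA''e=\{exe : x\in A''\}$ is one dimensional over $\mathbb{C}$. Then $A$ is finite dimensional if and only if $A$ contains all minimal projections of $A''$. -/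

import Mathlib

noncomputable section

/-- The involution `f ↦ f⋆`, `f⋆(a) = conj (f (a⋆))`, on the dual `A'` of a C⋆-algebra `A`,
as a continuous conjugate-linear map. -/
def dualStar (A : Type*) [CStarAlgebra A] : StrongDual ℂ A →L⋆[ℂ] StrongDual ℂ A :=
  LinearMap.mkContinuous
    { toFun := fun f =>
        (starL ℂ : ℂ ≃L⋆[ℂ] ℂ).toContinuousLinearMap.comp
          (f.comp (starL ℂ : A ≃L⋆[ℂ] A).toContinuousLinearMap)
      map_add' := fun f g => by ext a; simp
      map_smul' := fun c f => by ext a; simp }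
    1 (fun f => by
      rw [one_mul]
      refine ContinuousLinearMap.opNorm_le_bound _ (norm_nonneg f) (fun a => ?_)
      simpa using f.le_opNorm (star a))

@[simp]
theorem dualStar_apply {A : Type*} [CStarAlgebra A] (f : StrongDual ℂ A) (a : A) :
    dualStar A f a = star (f (star a)) := rfl

/-- The bidual `A''` of a C⋆-algebra `A`, i.e. its second Banach space dual. It is a type
synonym, which carries the (first) Arens product and the canonical involution; with these
it is the bidual von Neumann algebra of `A`. -/
def CStarBidual (A : Type*) [CStarAlgebra A] : Type _ := StrongDual ℂ (StrongDual ℂ A)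

namespace CStarBidual

instance (A : Type*) [CStarAlgebra A] : NormedAddCommGroup (CStarBidual A) :=
  inferInstanceAs (NormedAddCommGroup (StrongDual ℂ (StrongDual ℂ A)))

instance (A : Type*) [CStarAlgebra A] : NormedSpace ℂ (CStarBidual A) :=
  inferInstanceAs (NormedSpace ℂ (StrongDual ℂ (StrongDual ℂ A)))

instance (A : Type*) [CStarAlgebra A] : FunLike (CStarBidual A) (StrongDual ℂ A) ℂ :=
  inferInstanceAs (FunLike (StrongDual ℂ (StrongDual ℂ A)) (StrongDual ℂ A) ℂ)

variable {A : Type*} [CStarAlgebra A]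

@[ext]
theorem ext {F G : CStarBidual A} (h : ∀ f, F f = G f) : F = G := DFunLike.ext F G h

@[simp]
theorem add_apply (F G : CStarBidual A) (f : StrongDual ℂ A) : (F + G) f = F f + G f := rfl

@[simp]
theorem zero_apply (f : StrongDual ℂ A) : (0 : CStarBidual A) f = 0 := rfl

@[simp]
theorem smul_apply (c : ℂ) (F : CStarBidual A) (f : StrongDual ℂ A) :
    (c • F) f = c * F f := rfl

@[simp]
theorem map_add_dual (F : CStarBidual A) (f g : StrongDual ℂ A) : F (f + g) = F f + F g :=
  ContinuousLinearMap.map_add (show StrongDual ℂ (StrongDual ℂ A) from F) f g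

@[simp]
theorem map_smul_dual (F : CStarBidual A) (c : ℂ) (f : StrongDual ℂ A) :
    F (c • f) = c * F f :=
  ContinuousLinearMap.map_smul (show StrongDual ℂ (StrongDual ℂ A) from F) c f

/-- The canonical embedding of `A` into its bidual, `a ↦ (f ↦ f a)`. -/
def incl (A : Type*) [CStarAlgebra A] : A →L[ℂ] CStarBidual A :=
  NormedSpace.inclusionInDoubleDual ℂ A

@[simp]
theorem incl_apply (a : A) (f : StrongDual ℂ A) : incl A a f = f a := rfl

/-- The right action `f · a` of `A` on its dual, `(f · a)(b) = f (a b)`, as a function of `a`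
with `f` fixed. -/
def dualMul (f : StrongDual ℂ A) : A →L[ℂ] StrongDual ℂ A :=
  (ContinuousLinearMap.compL ℂ A A ℂ f).comp (ContinuousLinearMap.mul ℂ A)

@[simp]
theorem dualMul_apply (f : StrongDual ℂ A) (a b : A) : dualMul f a b = f (a * b) := rfl

/-- The left action `G · f` of the bidual on the dual, `(G · f)(a) = G (f · a)`, as a
continuous linear function of `f` with `G` fixed. -/
def bidualAct (G : CStarBidual A) : StrongDual ℂ A →L[ℂ] StrongDual ℂ A :=
  LinearMap.mkContinuous
    { toFun := fun f => ContinuousLinearMap.comp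
        (show StrongDual ℂ (StrongDual ℂ A) from G) (dualMul f)
      map_add' := fun f g => by
        ext a
        exact map_add_dual G (dualMul f a) (dualMul g a)
      map_smul' := fun c f => by
        ext a
        exact map_smul_dual G c (dualMul f a) }
    ‖G‖ (fun f => by
      refine ContinuousLinearMap.opNorm_le_bound _ (by positivity) (fun a => ?_)
      have h1 : ‖G (dualMul f a)‖ ≤ ‖G‖ * ‖dualMul f a‖ :=
        ContinuousLinearMap.le_opNorm (show StrongDual ℂ (StrongDual ℂ A) from G) _
      have h2 : ‖dualMul f a‖ ≤ ‖f‖ * ‖a‖ := by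
        refine ContinuousLinearMap.opNorm_le_bound _ (by positivity) (fun b => ?_)
        calc ‖f (a * b)‖ ≤ ‖f‖ * ‖a * b‖ := f.le_opNorm _
          _ ≤ ‖f‖ * (‖a‖ * ‖b‖) := by gcongr; exact norm_mul_le a b
          _ = ‖f‖ * ‖a‖ * ‖b‖ := by ring
      calc ‖G (dualMul f a)‖ ≤ ‖G‖ * ‖dualMul f a‖ := h1
        _ ≤ ‖G‖ * (‖f‖ * ‖a‖) := by gcongr
        _ = ‖G‖ * ‖f‖ * ‖a‖ := by ring)

@[simp]
theorem bidualAct_apply (G : CStarBidual A) (f : StrongDual ℂ A) (a : A) :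
    bidualAct G f a = G (dualMul f a) := rfl

/-- The (first) Arens product on the bidual, `(F G)(f) = F (G · f)`. -/
instance : Mul (CStarBidual A) where
  mul F G := ContinuousLinearMap.comp
    (show StrongDual ℂ (StrongDual ℂ A) from F) (bidualAct G)

@[simp]
theorem mul_apply (F G : CStarBidual A) (f : StrongDual ℂ A) :
    (F * G) f = F (bidualAct G f) := rfl

/-- The involution on the bidual, `F⋆(f) = conj (F (f⋆))`. -/
instance : Star (CStarBidual A) where
  star F := (starL ℂ : ℂ ≃L⋆[ℂ] ℂ).toContinuousLinearMap.comp
    ((show StrongDual ℂ (StrongDual ℂ A) from F).comp (dualStar A))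

@[simp]
theorem star_apply (F : CStarBidual A) (f : StrongDual ℂ A) :
    (star F) f = star (F (dualStar A f)) := rfl

instance : NonUnitalRing (CStarBidual A) where
  left_distrib F G H := by
    ext f
    simp only [mul_apply, add_apply, ← map_add_dual]
    rfl
  right_distrib F G H := by ext f; rfl
  zero_mul F := by ext f; rfl
  mul_zero F := by
    ext f
    have h : bidualAct (0 : CStarBidual A) f = 0 := by ext a; rfl
    rw [mul_apply, h]
    exact ContinuousLinearMap.map_zero (show StrongDual ℂ (StrongDual ℂ A) from F)
  mul_assoc F G H := by
    ext f
    simp only [mul_apply]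
    congr 1
    ext a
    simp only [bidualAct_apply, mul_apply]
    congr 1
    ext b
    simp only [bidualAct_apply, dualMul_apply]
    congr 1
    ext c
    simp [mul_assoc]

instance : IsScalarTower ℂ (CStarBidual A) (CStarBidual A) where
  smul_assoc c F G := by ext f; rfl

instance : SMulCommClass ℂ (CStarBidual A) (CStarBidual A) where
  smul_comm c F G := by
    ext f
    simp only [smul_eq_mul, mul_apply, smul_apply, ← map_smul_dual]
    rfl

/-- The canonical embedding `A → A''` is multiplicative. -/
theorem incl_mul (a b : A) : incl A (a * b) = incl A a * incl A b := by ext f; rfl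

/-- The canonical embedding `A → A''` preserves the involution. -/
theorem incl_star (a : A) : incl A (star a) = star (incl A a) := by ext f; simp

end CStarBidual

/-- A minimal projection of a ⋆-algebra `B` over `ℂ`: a self-adjoint idempotent `e` for which
`e B e = {e x e | x ∈ B}` is one dimensional. -/
def IsMinimalProjection {B : Type*} [NonUnitalRing B] [Star B] [Module ℂ B]
    [IsScalarTower ℂ B B] [SMulCommClass ℂ B B] (e : B) : Prop :=
  IsStarProjection e ∧
    Module.finrank ℂ (LinearMap.range (LinearMap.mulLeftRight ℂ (e, e) : B →ₗ[ℂ] B)) = 1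

end

/-!
Write `φ` for a pure state of `A`. The proof rests on two facts.

*Every pure state `φ` has a minimal projection `e` in the bidual with `e(φ) = 1`*
(`CStarBidual.exists_isMinimalProjection`). Purity, in the form "every positive functional below
`φ` is a multiple of `φ`", gives by Hahn–Banach duality that finitely many self-adjoint elements in
the kernel of `φ` have a common upper bound `y` with `φ(y)` as small as desired
(`IsPureState.exists_upperBound`). With `v = (1 + t y)⁻¹` this shows that `φ` is excised by positive
contractions: along a suitable ultrafilter, `φ(v) → 1` and `‖v x v - φ(x) v²‖ → 0` for every `x`
(`IsPureState.exists_ultrafilter`). Let `e` be the weak-⋆ limit of `v`. As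
`‖x v‖² = ‖v x⋆ x v‖`, each functional `g = e · f` is bounded for the GNS seminorm of `φ`, hence is
approximated by functionals `φ(z⋆ ·)`; since `v z ξ → φ(z) ξ` in the GNS space, the functionals
`g(v ·)` converge in norm to `e(f) φ`. This means `e F e = F(φ) e` for all `F`.

*If every pure state is nonzero on some projection `p` of `A` with `p A p ⊆ ℂ p`, then `A` is
finite dimensional* (`finiteDimensional_of_isPureState`). If no positive combination of such
projections dominates `1`, then some state vanishes on all of them, and by Krein–Milman some
pure state does. So there is a positive combination `z ≥ 1`. It is invertible, and `x ↦ z x z`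
embeds `A` into a finite sum of spaces `p A q`, each of dimension at most one.

If `A` contains all minimal projections of its bidual, then the `e` belonging to a pure state lies
in `A`, and `e A e ⊆ ℂ e`. Conversely, a finite dimensional `A` is reflexive.
-/

open Filter Topology
open scoped ComplexStarModule ComplexOrder

/-! ### Pure states of ordered real vector spaces -/

section OrderedSpace

variable {E : Type*} [AddCommGroup E] [PartialOrder E] [Module ℝ E]

/-- A pure state of an ordered real vector space with order unit `u`: a positive functional `L`
with `L u = 1` such that every positive functional dominated by `L` is a multiple of `L`. -/
structure IsPureState (u : E) (L : E →ₗ[ℝ] ℝ) : Prop where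
  nonneg : ∀ x, 0 ≤ x → 0 ≤ L x
  map_unit : L u = 1
  eq_smul : ∀ ψ : E →ₗ[ℝ] ℝ, (∀ x, 0 ≤ x → 0 ≤ ψ x) → (∀ x, 0 ≤ x → ψ x ≤ L x) →
    ψ = ψ u • L

variable [IsOrderedAddMonoid E]

/-- The states that vanish on `Z`, as a subset of the product space `E → ℝ`; in this form they
are a compact set in the product topology. -/
def stateSetVanishing (u : E) (Z : Set E) : Set (E → ℝ) :=
  {f | (∀ x y, f (x + y) = f x + f y) ∧ (∀ (c : ℝ) x, f (c • x) = c * f x) ∧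
    (∀ x, 0 ≤ x → 0 ≤ f x) ∧ f u = 1 ∧ ∀ z ∈ Z, f z = 0}

theorem LinearMap.mono_of_nonneg {L : E →ₗ[ℝ] ℝ} (hL : ∀ x, 0 ≤ x → 0 ≤ L x) {x y : E}
    (h : x ≤ y) : L x ≤ L y := by
  simpa using hL (y - x) (sub_nonneg.2 h)

theorem isCompact_stateSetVanishing {u : E} (hu : ∀ x : E, ∃ r : ℝ, x ≤ r • u) (Z : Set E) :
    IsCompact (stateSetVanishing u Z) := by
  choose r hr using hu
  refine (isCompact_univ_pi fun x : E => isCompact_Icc (a := -r (-x)) (b := r x)).of_isClosed_subset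
    ?_ fun f hf => ?_
  · simp only [stateSetVanishing, Set.ofPred_and, Set.ofPred_forall]
    refine .inter (isClosed_iInter fun x => isClosed_iInter fun y => isClosed_eq (by fun_prop)
      (by fun_prop)) (.inter (isClosed_iInter fun c => isClosed_iInter fun x =>
      isClosed_eq (by fun_prop) (by fun_prop)) (.inter (isClosed_iInter fun x =>
      isClosed_iInter fun _ => isClosed_le (by fun_prop) (by fun_prop)) (.inter
      (isClosed_eq (by fun_prop) (by fun_prop)) (isClosed_iInter fun z =>
      isClosed_iInter fun _ => isClosed_eq (by fun_prop) (by fun_prop)))))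
  · obtain ⟨hadd, hsmul, hpos, hone, -⟩ := hf
    let L : E →ₗ[ℝ] ℝ := { toFun := f, map_add' := hadd, map_smul' := hsmul }
    have key : ∀ x, f x ≤ r x := fun x => by
      have := LinearMap.mono_of_nonneg (L := L) hpos (hr x)
      simpa [L, hsmul, hone] using this
    intro x _
    have h1 := key (-x)
    have h2 : f (-x) = -f x := L.map_neg x
    exact ⟨by linarith, key x⟩

/-- Krein–Milman: if some state vanishes on a set `Z` of positive elements, then so does some
pure state. -/
theorem exists_isPureState_of_state {u : E} (hu₀ : 0 ≤ u)
    (hu : ∀ x : E, ∃ r : ℝ, x ≤ r • u) {Z : Set E} (hZ : ∀ z ∈ Z, 0 ≤ z)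
    {L₀ : E →ₗ[ℝ] ℝ} (h₀ : ∀ x, 0 ≤ x → 0 ≤ L₀ x) (h₀u : L₀ u = 1)
    (h₀Z : ∀ z ∈ Z, L₀ z = 0) :
    ∃ L : E →ₗ[ℝ] ℝ, IsPureState u L ∧ ∀ z ∈ Z, L z = 0 := by
  obtain ⟨f, hf⟩ := (isCompact_stateSetVanishing hu Z).extremePoints_nonempty
    ⟨L₀, L₀.map_add, L₀.map_smul, h₀, h₀u, h₀Z⟩
  rw [mem_extremePoints] at hf
  obtain ⟨⟨hadd, hsmul, hpos, hone, hfZ⟩, hext⟩ := hf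
  let L : E →ₗ[ℝ] ℝ := { toFun := f, map_add' := hadd, map_smul' := hsmul }
  have hLu : L u = 1 := hone
  -- a positive functional that vanishes at the order unit is zero
  have hzero : ∀ ψ : E →ₗ[ℝ] ℝ, (∀ x, 0 ≤ x → 0 ≤ ψ x) → ψ u = 0 → ψ = 0 := by
    intro ψ hψ hψu
    have key : ∀ x, ψ x ≤ 0 := fun x => by
      obtain ⟨r, hr⟩ := hu x
      simpa [hψu] using LinearMap.mono_of_nonneg hψ hr
    ext x
    have := key (-x)
    rw [map_neg] at this
    exact le_antisymm (key x) (neg_nonpos.1 this)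
  have hmem : ∀ ψ : E →ₗ[ℝ] ℝ, (∀ x, 0 ≤ x → 0 ≤ ψ x) → (∀ x, 0 ≤ x → ψ x ≤ L x) → 0 < ψ u →
      ⇑((ψ u)⁻¹ • ψ) ∈ stateSetVanishing u Z := by
    intro ψ hψ hψL hψu
    refine ⟨map_add _, fun c x => by simp, fun x hx => ?_, ?_, fun z hz => ?_⟩
    · have := hψ x hx
      simp only [LinearMap.smul_apply, smul_eq_mul]
      positivity
    · simp [hψu.ne']
    · have h1 := hψ z (hZ z hz)
      have h2 : ψ z ≤ 0 := (hψL z (hZ z hz)).trans_eq (hfZ z hz)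
      simp [le_antisymm h2 h1]
  refine ⟨L, ⟨hpos, hone, fun ψ hψ hψL => ?_⟩, hfZ⟩
  have hχ : ∀ x, 0 ≤ x → 0 ≤ (L - ψ) x := fun x hx => by simpa using hψL x hx
  have hχL : ∀ x, 0 ≤ x → (L - ψ) x ≤ L x := fun x hx => by simpa using hψ x hx
  have hsum : ψ u + (L - ψ) u = 1 := by simp [hLu]
  rcases (hψ u hu₀).eq_or_lt with h | h
  · rw [hzero ψ hψ h.symm]; simp
  rcases (hχ u hu₀).eq_or_lt with h' | h'
  · have h1 : L - ψ = 0 := hzero _ hχ h'.symm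
    have h2 : L = ψ := sub_eq_zero.1 h1
    rw [← h2, hLu, one_smul]
  have h1 := (hext _ (hmem ψ hψ hψL h) _ (hmem _ hχ hχL h') ⟨ψ u, (L - ψ) u, h, h', hsum, ?_⟩).1
  · ext x
    have h2 : (ψ u)⁻¹ * ψ x = L x := congrFun h1 x
    rw [LinearMap.smul_apply, ← h2, smul_eq_mul, mul_inv_cancel_left₀ h.ne']
  · ext x
    have h2 : f x = L x := rfl
    simp only [Pi.add_apply, Pi.smul_apply, LinearMap.smul_apply, smul_eq_mul,
      mul_inv_cancel_left₀ h.ne', mul_inv_cancel_left₀ h'.ne', h2]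
    simp

/-- The M. Riesz extension theorem for a functional given on the source of an injective map. -/
theorem exists_nonneg_extension {F D : Type*} [AddCommGroup F] [Module ℝ F] [AddCommGroup D]
    [Module ℝ D] (C : PointedCone ℝ F) (j : D →ₗ[ℝ] F) (hj : Function.Injective j)
    (f : D →ₗ[ℝ] ℝ) (hf : ∀ d, j d ∈ C → 0 ≤ f d) (hC : ∀ y, ∃ d, j d + y ∈ C) :
    ∃ g : F →ₗ[ℝ] ℝ, (∀ d, g (j d) = f d) ∧ ∀ x ∈ C, 0 ≤ g x := by
  have hnonneg : ∀ x : (⟨LinearMap.range j,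
      f ∘ₗ (LinearEquiv.ofInjective j hj).symm.toLinearMap⟩ : F →ₗ.[ℝ] ℝ).domain, (x : F) ∈ C →
      0 ≤ f ((LinearEquiv.ofInjective j hj).symm x) := by
    rintro ⟨_, d, rfl⟩ hd
    have h : (⟨j d, d, rfl⟩ : LinearMap.range j) = LinearEquiv.ofInjective j hj d := rfl
    rw [h, LinearEquiv.symm_apply_apply]
    exact hf d hd
  obtain ⟨g, hg, hgC⟩ := riesz_extension C _ hnonneg fun y => by
    obtain ⟨d, hd⟩ := hC y
    exact ⟨⟨j d, d, rfl⟩, hd⟩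
  refine ⟨g, fun d => ?_, hgC⟩
  have := hg (LinearEquiv.ofInjective j hj d)
  simpa using this

variable [PosSMulMono ℝ E]

/-- A cone of positive elements none of which dominates the order unit `u` is annihilated by
some state. -/
theorem exists_state_of_not_le {u : E} (hu : ∀ x : E, ∃ r : ℝ, x ≤ r • u)
    (Z : PointedCone ℝ E) (hZ : ∀ z ∈ Z, 0 ≤ z) (huZ : ∀ z ∈ Z, ¬ u ≤ z) :
    ∃ L : E →ₗ[ℝ] ℝ, (∀ x, 0 ≤ x → 0 ≤ L x) ∧ L u = 1 ∧ ∀ z ∈ Z, L z = 0 := by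
  -- nonnegativity on `C` amounts to positivity together with vanishing on `Z`
  let C : PointedCone ℝ E :=
    { carrier := {x | ∃ z ∈ Z, 0 ≤ x + z}
      zero_mem' := ⟨0, Z.zero_mem, by simp⟩
      add_mem' := by
        rintro x y ⟨z, hz, hxz⟩ ⟨w, hw, hyw⟩
        exact ⟨z + w, Z.add_mem hz hw, by rw [add_add_add_comm]; exact add_nonneg hxz hyw⟩
      smul_mem' := by
        rintro ⟨c, hc⟩ x ⟨z, hz, hxz⟩
        refine ⟨c • z, Z.smul_mem hc hz, ?_⟩
        have := smul_nonneg hc hxz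
        rwa [smul_add] at this }
  have hune : u ≠ 0 := fun h => huZ 0 Z.zero_mem h.le
  have hnonneg : ∀ c : ℝ, LinearMap.toSpanSingleton ℝ E u c ∈ C → 0 ≤ LinearMap.id (R := ℝ) c := by
    rintro c ⟨z, hz, hcz⟩
    rw [LinearMap.toSpanSingleton_apply] at hcz
    by_contra! hc
    rw [LinearMap.id_apply] at hc
    have hc' : 0 ≤ (-c)⁻¹ := by rw [inv_nonneg]; linarith
    refine huZ _ (Z.smul_mem hc' hz) ?_
    have h := smul_nonneg hc' hcz
    rw [smul_add, smul_smul, inv_neg, neg_mul, inv_mul_cancel₀ hc.ne, neg_one_smul, ← inv_neg,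
      neg_add_eq_sub, sub_nonneg] at h
    exact h
  obtain ⟨L, hL, hLC⟩ := exists_nonneg_extension C (LinearMap.toSpanSingleton ℝ E u)
    (smul_left_injective ℝ hune) LinearMap.id hnonneg fun y => by
      obtain ⟨r, hr⟩ := hu (-y)
      refine ⟨r, 0, Z.zero_mem, ?_⟩
      simpa [neg_le_iff_add_nonneg] using hr
  have hpos : ∀ x, 0 ≤ x → 0 ≤ L x := fun x hx => hLC x ⟨0, Z.zero_mem, by simpa using hx⟩
  refine ⟨L, hpos, by simpa using hL 1, fun z hz => le_antisymm ?_ (hpos z (hZ z hz))⟩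
  have := hLC (-z) ⟨z, hz, by simp⟩
  rw [map_neg] at this
  exact neg_nonneg.1 this

/-- Finitely many elements in the kernel of a pure state have upper bounds on which the state is
arbitrarily small. By duality, the infimum of `L` over the upper bounds of `(x i)` is the supremum
of `∑ i, ψ i (x i)` over all decompositions `L = ∑ i, ψ i` into positive functionals, and purity
of `L` makes each of these sums zero. -/
theorem IsPureState.exists_upperBound {u : E} (hu₀ : 0 ≤ u) (hu : ∀ x : E, ∃ r : ℝ, x ≤ r • u)
    {L : E →ₗ[ℝ] ℝ} (hL : IsPureState u L) {ι : Type*} [Finite ι] [Nonempty ι] (x : ι → E)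
    (hx : ∀ i, L (x i) = 0) {δ : ℝ} (hδ : 0 < δ) : ∃ y, (∀ i, x i ≤ y) ∧ L y < δ := by
  classical
  cases nonempty_fintype ι
  by_contra! hcon
  -- on pairs `(a, s)`, ordered through `a + s • x`, the functional `(y, s) ↦ L y + s * δ` on the
  -- diagonal is positive by `hcon`; the extra coordinate spares the case of `x` on the diagonal
  let C : PointedCone ℝ ((ι → E) × ℝ) :=
    { carrier := {p | ∀ i, 0 ≤ p.1 i + p.2 • x i}
      zero_mem' := by simp
      add_mem' := by
        intro p q hp hq i
        have := add_nonneg (hp i) (hq i)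
        rwa [add_add_add_comm, ← add_smul] at this
      smul_mem' := by
        rintro ⟨c, hc⟩ p hp i
        have := smul_nonneg hc (hp i)
        rwa [smul_add, smul_smul] at this }
  let j : E × ℝ →ₗ[ℝ] (ι → E) × ℝ :=
    (LinearMap.pi fun _ => LinearMap.id).prodMap LinearMap.id
  have hjapp : ∀ (y : E) (s : ℝ), j (y, s) = (fun _ => y, s) := fun _ _ => rfl
  obtain ⟨i₀⟩ := ‹Nonempty ι›
  have hj : Function.Injective j := by
    rintro ⟨y, s⟩ ⟨y', s'⟩ h
    rw [hjapp, hjapp, Prod.mk.injEq] at h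
    exact Prod.ext (congrFun h.1 i₀) h.2
  have hnonneg : ∀ d, j d ∈ C → 0 ≤ L.coprod (LinearMap.toSpanSingleton ℝ ℝ δ) d := by
    rintro ⟨y, s⟩ hys
    have hys' : ∀ i, 0 ≤ y + s • x i := hys
    have goal : 0 ≤ L y + s * δ := by
      rcases le_or_gt 0 s with hs | hs
      · have := hL.nonneg _ (hys' i₀)
        rw [map_add, map_smul, hx i₀, smul_zero, add_zero] at this
        positivity
      · have hs' : 0 ≤ (-s)⁻¹ := by rw [inv_nonneg]; linarith
        have := hcon ((-s)⁻¹ • y) fun i => by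
          have h := smul_nonneg hs' (hys' i)
          rw [smul_add, smul_smul, inv_neg, neg_mul, inv_mul_cancel₀ hs.ne, neg_one_smul,
            ← inv_neg, ← sub_eq_add_neg, sub_nonneg] at h
          exact h
        rw [map_smul, smul_eq_mul, ← div_eq_inv_mul, le_div_iff₀ (by linarith)] at this
        linarith
    simpa using goal
  have hcof : ∀ p, ∃ d, j d + p ∈ C := by
    rintro ⟨a, s⟩
    choose r hr using fun i => hu (-a i)
    obtain ⟨R, hR⟩ : ∃ R : ℝ, ∀ i, r i ≤ R := ⟨∑ i, |r i|, fun i => (le_abs_self _).trans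
      (Finset.single_le_sum (f := fun i => |r i|) (fun _ _ => abs_nonneg _) (Finset.mem_univ i))⟩
    refine ⟨(R • u, -s), fun i => ?_⟩
    have h1 : r i • u ≤ R • u := by
      have := smul_nonneg (sub_nonneg.2 (hR i)) hu₀
      rwa [sub_smul, sub_nonneg] at this
    have h2 := (hr i).trans h1
    rw [hjapp]
    simpa [neg_le_iff_add_nonneg] using h2
  obtain ⟨g, hg, hgC⟩ := exists_nonneg_extension C j hj _ hnonneg hcof
  let ψ : ι → E →ₗ[ℝ] ℝ := fun i =>
    g ∘ₗ LinearMap.inl ℝ (ι → E) ℝ ∘ₗ LinearMap.single ℝ (fun _ => E) i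
  have hψapp : ∀ i y, ψ i y = g (Pi.single i y, 0) := fun _ _ => rfl
  have hψsum : ∀ a : ι → E, ∑ i, ψ i (a i) = g (a, 0) := by
    intro a
    have : (a, (0 : ℝ)) = ∑ i, LinearMap.inl ℝ (ι → E) ℝ (Pi.single i (a i)) := by
      rw [← map_sum, Finset.univ_sum_single]; rfl
    rw [this, map_sum]; rfl
  have hψpos : ∀ i y, 0 ≤ y → 0 ≤ ψ i y := by
    intro i y hy
    refine hgC _ fun k => ?_
    by_cases hk : k = i
    · subst hk; simpa using hy
    · simp [hk]
  have hψL : ∀ y, ∑ i, ψ i y = L y := by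
    intro y
    rw [hψsum fun _ => y, ← hjapp, hg]; simp
  have hψx : ∀ i, ψ i (x i) = 0 := by
    intro i
    rw [hL.eq_smul (ψ i) (hψpos i) fun y hy => ?_]
    · simp [hx i]
    · rw [← hψL y]
      exact Finset.single_le_sum (f := fun i => ψ i y) (fun k _ => hψpos k y hy)
        (Finset.mem_univ i)
  have h1 : g (x, 0) = 0 := by rw [← hψsum x]; exact Finset.sum_eq_zero fun i _ => hψx i
  have h2 : g (0, 1) = δ := by
    have := hg (0, 1)
    rw [hjapp] at this
    have h0 : (fun _ => 0 : ι → E) = 0 := rfl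
    simpa [h0] using this
  have h3 : 0 ≤ g (x, -1) := hgC _ fun i => by simp
  have h4 : ((x, -1) : (ι → E) × ℝ) = (x, 0) - (0, 1) := by simp
  rw [h4, map_sub, h1, h2] at h3
  linarith

end OrderedSpace

/-! ### Excision of pure states -/

section Excision

variable {A : Type*} [CStarAlgebra A]

/-- The complex-linear functional on `A` that extends a real functional on the self-adjoint
elements. -/
noncomputable def selfAdjointExtend (L : selfAdjoint A →ₗ[ℝ] ℝ) : A →ₗ[ℂ] ℂ where
  toFun a := L (ℜ a) + L (ℑ a) * Complex.I
  map_add' a b := by simp; ring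
  map_smul' c a := by
    apply Complex.ext <;> simp [realPart_smul, imaginaryPart_smul]

theorem selfAdjointExtend_apply (L : selfAdjoint A →ₗ[ℝ] ℝ) (a : A) :
    selfAdjointExtend L a = L (ℜ a) + L (ℑ a) * Complex.I := rfl

theorem selfAdjointExtend_coe (L : selfAdjoint A →ₗ[ℝ] ℝ) (x : selfAdjoint A) :
    selfAdjointExtend L (x : A) = L x := by
  simp [selfAdjointExtend_apply]

variable [PartialOrder A] [StarOrderedRing A]

theorem selfAdjoint.posSMulMono : PosSMulMono ℝ (selfAdjoint A) where
  smul_le_smul_of_nonneg_left c hc x y hxy := by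
    have h : (x : A) ≤ y := hxy
    change c • (x : A) ≤ c • (y : A)
    exact smul_le_smul_of_nonneg_left h hc

theorem selfAdjoint.exists_le_smul_one (x : selfAdjoint A) : ∃ r : ℝ, x ≤ r • 1 := by
  refine ⟨‖(x : A)‖, ?_⟩
  change (x : A) ≤ ‖(x : A)‖ • (1 : A)
  rw [← Algebra.algebraMap_eq_smul_one]
  exact IsSelfAdjoint.le_algebraMap_norm_self x.2

theorem selfAdjoint.zero_le_one : (0 : selfAdjoint A) ≤ 1 := by
  change (0 : A) ≤ 1
  exact _root_.zero_le_one

/-- The positive functional on `A` given by a positive real functional on its self-adjoint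
elements. -/
noncomputable def positiveExtend (L : selfAdjoint A →ₗ[ℝ] ℝ)
    (hL : ∀ x, 0 ≤ x → 0 ≤ L x) : A →ₚ[ℂ] ℂ :=
  PositiveLinearMap.mk₀ (selfAdjointExtend L) fun a ha => by
    have h := selfAdjointExtend_coe L ⟨a, .of_nonneg ha⟩
    rw [show selfAdjointExtend L a = _ from h]
    exact_mod_cast hL ⟨a, .of_nonneg ha⟩ ha

theorem positiveExtend_coe {L : selfAdjoint A →ₗ[ℝ] ℝ} (hL : ∀ x, 0 ≤ x → 0 ≤ L x)
    (x : selfAdjoint A) : positiveExtend L hL (x : A) = L x :=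
  selfAdjointExtend_coe L x

theorem norm_le_of_mem_Icc_neg {x : A} {r : ℝ} (hr : 0 ≤ r) (h₁ : -algebraMap ℝ A r ≤ x)
    (h₂ : x ≤ algebraMap ℝ A r) : ‖x‖ ≤ 3 * r := by
  have hn : ‖algebraMap ℝ A r‖ ≤ r := by
    have h : (0 : A) ≤ algebraMap ℝ A r := algebraMap_nonneg A hr
    rw [CStarAlgebra.norm_le_iff_le_algebraMap _ hr h]
  have h3 : ‖x + algebraMap ℝ A r‖ ≤ 2 * r := by
    rw [CStarAlgebra.norm_le_iff_le_algebraMap _ (by positivity) (neg_le_iff_add_nonneg.1 h₁),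
      two_mul, map_add]
    gcongr
  calc ‖x‖ = ‖(x + algebraMap ℝ A r) - algebraMap ℝ A r‖ := by rw [add_sub_cancel_right]
    _ ≤ 2 * r + r := (norm_sub_le _ _).trans (add_le_add h3 hn)
    _ = 3 * r := by ring

/-- The element `v = (1 + t y)⁻¹`, for `y ≥ 0`, is close to `1` where `y` is small, while
`v y v` has norm at most `1 / t`. -/
theorem exists_compression {y : A} (hy : 0 ≤ y) {t : ℝ} (ht : 0 < t) :
    ∃ v : A, 0 ≤ v ∧ v ≤ 1 ∧ 1 - v ≤ t • y ∧ v * y * v ≤ algebraMap ℝ A t⁻¹ := by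
  have hsp : ∀ s ∈ spectrum ℝ y, 0 ≤ s := fun s hs => spectrum_nonneg_of_nonneg hy hs
  have hpos : ∀ s ∈ spectrum ℝ y, 0 < 1 + t * s := fun s hs => by
    have := hsp s hs
    positivity
  have hcont : ContinuousOn (fun s : ℝ => (1 + t * s)⁻¹) (spectrum ℝ y) :=
    ContinuousOn.inv₀ (by fun_prop) fun s hs => (hpos s hs).ne'
  have hysa : IsSelfAdjoint y := .of_nonneg hy
  refine ⟨cfc (fun s : ℝ => (1 + t * s)⁻¹) y, cfc_nonneg fun s hs => (inv_pos.2 (hpos s hs)).le,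
    cfc_le_one _ _ fun s hs => ?_, ?_, ?_⟩
  · have := hsp s hs
    exact inv_le_one_of_one_le₀ (by nlinarith)
  · nth_rw 1 [← cfc_one ℝ y]
    nth_rw 3 [← cfc_id ℝ y]
    rw [← cfc_smul t id y, ← cfc_sub _ _ y]
    refine cfc_mono fun s hs => ?_
    have h1 := hsp s hs
    have h2 := hpos s hs
    simp only [Pi.one_apply, id, smul_eq_mul]
    rw [sub_le_iff_le_add, ← mul_le_mul_iff_left₀ h2, add_mul, inv_mul_cancel₀ h2.ne']
    nlinarith [mul_nonneg ht.le h1, mul_nonneg (mul_nonneg ht.le h1) (mul_nonneg ht.le h1)]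
  · nth_rw 2 [← cfc_id ℝ y]
    rw [← cfc_mul _ _ y, ← cfc_mul _ _ y]
    refine cfc_le_algebraMap _ _ _ fun s hs => ?_
    have h1 := hsp s hs
    have h2 := hpos s hs
    simp only [id]
    rw [mul_assoc, mul_comm, mul_assoc, ← mul_inv, ← div_eq_mul_inv, inv_eq_one_div,
      div_le_div_iff₀ (by positivity) ht]
    nlinarith [mul_nonneg ht.le h1, mul_nonneg (mul_nonneg ht.le h1) (mul_nonneg ht.le h1)]

/-- Excision: on every finite set of elements, a pure state is implemented up to `ε` by
compression to some positive contraction `v`. -/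
theorem IsPureState.exists_excising {L : selfAdjoint A →ₗ[ℝ] ℝ} (hL : IsPureState 1 L)
    (S : Finset A) {ε : ℝ} (hε : 0 < ε) :
    ∃ v : A, 0 ≤ v ∧ v ≤ 1 ∧ ‖positiveExtend L hL.nonneg (1 - v)‖ < ε ∧
      ∀ x ∈ S, ‖v * x * v - positiveExtend L hL.nonneg x • (v * v)‖ < ε := by
  have := selfAdjoint.posSMulMono (A := A)
  set φ := positiveExtend L hL.nonneg
  -- the index `none` forces the upper bound `y` to be positive
  let w : Option (S ⊕ S) → selfAdjoint A := fun o => o.elim 0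
    (Sum.elim (fun z => ℜ (z : A) - L (ℜ (z : A)) • 1) (fun z => ℑ (z : A) - L (ℑ (z : A)) • 1))
  have hw : ∀ i, L (w i) = 0 := by
    rintro (_ | z | z) <;> simp [w, hL.map_unit]
  obtain ⟨t, ht, htε⟩ : ∃ t : ℝ, 0 < t ∧ 6 * t⁻¹ < ε :=
    ⟨12 / ε, by positivity, by rw [inv_div]; linarith⟩
  obtain ⟨y, hy, hyε⟩ := hL.exists_upperBound selfAdjoint.zero_le_one
    selfAdjoint.exists_le_smul_one (Sum.elim w (-w))
    (by rintro (i | i) <;> simp [hw]) (δ := ε / t) (by positivity)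
  have hy₁ : ∀ i, (w i : A) ≤ y := fun i => hy (.inl i)
  have hy₂ : ∀ i, -(w i : A) ≤ y := fun i => hy (.inr i)
  have hy₀ : (0 : A) ≤ y := hy₁ none
  obtain ⟨v, hv₀, hv₁, hvy, hvyv⟩ := exists_compression hy₀ ht
  have hv : IsSelfAdjoint v := .of_nonneg hv₀
  have hbound : ∀ i, ‖v * w i * v‖ ≤ 3 * t⁻¹ := fun i => by
    refine norm_le_of_mem_Icc_neg (by positivity) ?_
      ((hv.conjugate_le_conjugate (hy₁ i)).trans hvyv)
    rw [neg_le]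
    have := (hv.conjugate_le_conjugate (hy₂ i)).trans hvyv
    rwa [mul_neg, neg_mul] at this
  refine ⟨v, hv₀, hv₁, ?_, fun z hz => ?_⟩
  · have h1 : 0 ≤ φ (1 - v) := φ.map_nonneg (sub_nonneg.2 hv₁)
    have h2 : φ (1 - v) ≤ φ (t • (y : A)) := OrderHomClass.mono φ hvy
    have h3 : φ (t • (y : A)) = (t * L y : ℝ) := by
      rw [PositiveLinearMap.map_smul_of_tower, positiveExtend_coe]; simp
    rw [h3] at h2
    have h4 : ‖φ (1 - v)‖ ≤ ‖((t * L y : ℝ) : ℂ)‖ :=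
      CStarAlgebra.norm_le_norm_of_nonneg_of_le h1 h2
    refine h4.trans_lt ?_
    have h5 : 0 ≤ L y := hL.nonneg y hy₀
    rw [Complex.norm_real, Real.norm_of_nonneg (by positivity)]
    rwa [lt_div_iff₀' ht] at hyε
  · have h1 : v * z * v - φ z • (v * v) = v * w (some (.inl ⟨z, hz⟩)) * v +
        Complex.I • (v * w (some (.inr ⟨z, hz⟩)) * v) := by
      have h2 : φ z = L (ℜ z) + L (ℑ z) * Complex.I := rfl
      have h3 : z = (ℜ z : A) + Complex.I • (ℑ z : A) := (realPart_add_I_smul_imaginaryPart z).symm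
      have h4 : (w (some (.inl ⟨z, hz⟩)) : A) = ℜ z - (L (ℜ z) : ℂ) • 1 := by simp [w]
      have h5 : (w (some (.inr ⟨z, hz⟩)) : A) = ℑ z - (L (ℑ z) : ℂ) • 1 := by simp [w]
      rw [h4, h5, h2]
      nth_rw 1 [h3]
      simp only [mul_add, add_mul, mul_sub, sub_mul, mul_smul_comm, smul_mul_assoc, mul_one,
        smul_sub, smul_smul, add_smul]
      rw [mul_comm Complex.I]
      abel
    rw [h1]
    refine ((norm_add_le _ _).trans ?_).trans_lt htε
    rw [norm_smul, Complex.norm_I, one_mul]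
    linarith [hbound (some (.inl ⟨z, hz⟩)), hbound (some (.inr ⟨z, hz⟩))]

/-- Excision of a pure state along an ultrafilter on the algebra. -/
theorem IsPureState.exists_ultrafilter {L : selfAdjoint A →ₗ[ℝ] ℝ} (hL : IsPureState 1 L) :
    ∃ U : Ultrafilter A, (∀ᶠ v in (U : Filter A), 0 ≤ v ∧ v ≤ 1) ∧
      Tendsto (fun v => positiveExtend L hL.nonneg (1 - v)) U (𝓝 0) ∧
      ∀ x, Tendsto (fun v => v * x * v - positiveExtend L hL.nonneg x • (v * v)) U (𝓝 0) := by
  classical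
  choose v hv₀ hv₁ hv hvx using fun p : Finset A × ℕ =>
    hL.exists_excising p.1 (ε := 1 / (p.2 + 1)) (by positivity)
  have hlim : Tendsto (fun p : Finset A × ℕ => (1 / (p.2 + 1) : ℝ)) atTop (𝓝 0) :=
    by
    rw [← prod_atTop_atTop_eq]
    exact tendsto_one_div_add_atTop_nhds_zero_nat.comp tendsto_snd
  refine ⟨(Ultrafilter.of atTop).map v,
    Filter.eventually_map.2 (.of_forall fun p => ⟨hv₀ p, hv₁ p⟩), ?_, fun x => ?_⟩
  · refine Tendsto.mono_left ?_ (Filter.map_mono (Ultrafilter.of_le _))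
    rw [tendsto_map'_iff]
    exact squeeze_zero_norm (fun p => (hv p).le) hlim
  · refine Tendsto.mono_left ?_ (Filter.map_mono (Ultrafilter.of_le _))
    rw [tendsto_map'_iff]
    refine squeeze_zero_norm' ?_ hlim
    filter_upwards [eventually_ge_atTop (({x} : Finset A), 0)] with p hp
    exact (hvx p x (hp.1 (Finset.mem_singleton_self x))).le

end Excision

/-! ### The minimal projection of the bidual supporting a pure state -/

namespace CStarBidual

variable {A : Type*} [CStarAlgebra A]

/-- Banach–Alaoglu: an ultrafilter on the unit ball of `A` has a weak-⋆ limit in the bidual. -/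
theorem exists_ultrafilter_lim {U : Ultrafilter A} (hU : ∀ᶠ v in (U : Filter A), ‖v‖ ≤ 1) :
    ∃ e : CStarBidual A, ∀ f : StrongDual ℂ A, Tendsto (fun v => f v) U (𝓝 (e f)) := by
  have hbd : ∀ f : StrongDual ℂ A, ∀ᶠ v in (U : Filter A), ‖f v‖ ≤ ‖f‖ := fun f => by
    filter_upwards [hU] with v hv
    exact (f.le_opNorm v).trans (mul_le_of_le_one_right (norm_nonneg _) hv)
  have hex : ∀ f : StrongDual ℂ A, ∃ c : ℂ, Tendsto (fun v => f v) U (𝓝 c) := fun f => by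
    obtain ⟨c, -, hc⟩ := (isCompact_closedBall (0 : ℂ) ‖f‖).ultrafilter_le_nhds (U.map f) (by
      rw [le_principal_iff, Ultrafilter.coe_map, mem_map]
      filter_upwards [hbd f] with v hv
      simpa using hv)
    exact ⟨c, hc⟩
  choose c hc using hex
  let e : StrongDual ℂ (StrongDual ℂ A) := LinearMap.mkContinuous
    { toFun := c
      map_add' := fun f g => tendsto_nhds_unique (hc (f + g)) ((hc f).add (hc g))
      map_smul' := fun r f => tendsto_nhds_unique (hc (r • f)) ((hc f).const_smul r) }
    1 fun f => by
      rw [one_mul]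
      exact le_of_tendsto (hc f).norm (hbd f)
  exact ⟨e, hc⟩

theorem mul_incl_one (F : CStarBidual A) : F * incl A 1 = F := by
  ext f
  rw [mul_apply]
  congr 1
  ext a
  simp

theorem incl_injective : Function.Injective (incl A) :=
  (NormedSpace.inclusionInDoubleDualLi (E := A) ℂ).injective

theorem norm_one_le_one : ‖(1 : A)‖ ≤ 1 := by
  rcases subsingleton_or_nontrivial A with h | h
  · simp [Subsingleton.elim (1 : A) 0]
  · exact CStarRing.norm_one.le

variable [PartialOrder A] [StarOrderedRing A] (φ : A →ₚ[ℂ] ℂ)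

/-- A positive functional as an element of the dual. -/
noncomputable def toDual : StrongDual ℂ A where
  toLinearMap := φ.toLinearMap
  cont := map_continuous φ

@[simp]
theorem toDual_apply (a : A) : toDual φ a = φ a := rfl

/-- A functional on `A` that is bounded for the seminorm `x ↦ φ (x⋆ x) ^ (1/2)` of a positive
functional `φ` is approximated, in this seminorm, by functionals `x ↦ φ (z⋆ x)`. -/
theorem exists_approx_of_bound (g : A →ₗ[ℂ] ℂ) {C : ℝ}
    (hg : ∀ x, ‖g x‖ ≤ C * ‖φ.toPreGNS x‖) {ε : ℝ} (hε : 0 < ε) :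
    ∃ z : A, ∀ x, ‖g x - φ (star z * x)‖ ≤ ε * ‖φ.toPreGNS x‖ := by
  let g₀ : φ.PreGNS →L[ℂ] ℂ :=
    (g ∘ₗ φ.ofPreGNS.toLinearMap).mkContinuous C fun x => hg (φ.ofPreGNS x)
  let G : φ.GNS →L[ℂ] ℂ := g₀.extend UniformSpace.Completion.toComplL
  have hG : ∀ x, G (φ.toPreGNS x : φ.GNS) = g x := fun x =>
    g₀.extend_eq UniformSpace.Completion.denseRange_coe
      (UniformSpace.Completion.isUniformInducing_coe _) (φ.toPreGNS x)
  let η : φ.GNS := (InnerProductSpace.toDual ℂ φ.GNS).symm G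
  have hη : ∀ x, inner ℂ η x = G x := fun x => InnerProductSpace.toDual_symm_apply
  obtain ⟨z, hz⟩ := UniformSpace.Completion.denseRange_coe.exists_dist_lt η hε
  refine ⟨φ.ofPreGNS z, fun x => ?_⟩
  have h1 : g x - φ (star (φ.ofPreGNS z) * x) = inner ℂ (η - z) (φ.toPreGNS x : φ.GNS) := by
    rw [inner_sub_left, hη, hG, UniformSpace.Completion.inner_coe, φ.preGNS_inner_def]
    rfl
  rw [h1, ← UniformSpace.Completion.norm_coe (φ.toPreGNS x)]
  refine (norm_inner_le_norm _ _).trans ?_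
  gcongr
  rw [← dist_eq_norm]
  exact hz.le

variable {φ}

theorem norm_toPreGNS_le (hφ : φ 1 = 1) (x : A) : ‖φ.toPreGNS x‖ ≤ ‖x‖ := by
  have h1 := φ.norm_apply_le_of_nonneg (star x * x) (star_mul_self_nonneg x)
  rw [hφ, norm_one, one_mul, CStarRing.norm_star_mul_self, ← sq] at h1
  have h2 := congrArg norm (φ.preGNS_norm_sq (φ.toPreGNS x))
  rw [← Complex.ofReal_pow, Complex.norm_real, Real.norm_of_nonneg (sq_nonneg _)] at h2
  refine le_of_sq_le_sq ?_ (norm_nonneg _)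
  rw [h2]
  exact h1

theorem norm_toPreGNS_mul_le (a x : A) : ‖φ.toPreGNS (a * x)‖ ≤ ‖a‖ * ‖φ.toPreGNS x‖ := by
  refine ((φ.leftMulMapPreGNS a).le_opNorm (φ.toPreGNS x)).trans ?_
  gcongr
  exact LinearMap.mkContinuous_norm_le _ (norm_nonneg a) _

theorem norm_apply_star_mul_le (x y : A) :
    ‖φ (star x * y)‖ ≤ ‖φ.toPreGNS x‖ * ‖φ.toPreGNS y‖ :=
  norm_inner_le_norm (𝕜 := ℂ) (φ.toPreGNS x) (φ.toPreGNS y)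

section Ultrafilter

variable {U : Ultrafilter A} (hU : ∀ᶠ v in (U : Filter A), 0 ≤ v ∧ v ≤ 1)
  (hU₁ : Tendsto (fun v => φ (1 - v)) U (𝓝 0))
  (hUx : ∀ x, Tendsto (fun v => v * x * v - φ x • (v * v)) U (𝓝 0))
include hU

theorem eventually_norm_le_one : ∀ᶠ v in (U : Filter A), ‖v‖ ≤ 1 := by
  filter_upwards [hU] with v hv
  exact (CStarAlgebra.norm_le_one_iff_of_nonneg v hv.1).2 hv.2

include hU₁ in
/-- In the GNS space, `v ξ` tends to the cyclic vector `ξ`. -/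
theorem tendsto_toPreGNS_one_sub : Tendsto (fun v => ‖φ.toPreGNS (1 - v)‖) U (𝓝 0) := by
  have h1 : Tendsto (fun v => √‖φ (1 - v)‖) U (𝓝 0) := by
    simpa using hU₁.norm.sqrt
  refine squeeze_zero' (.of_forall fun v => norm_nonneg _) ?_ h1
  filter_upwards [hU] with v ⟨hv₀, hv₁⟩
  refine Real.le_sqrt_of_sq_le ?_
  have hs : 0 ≤ 1 - v := sub_nonneg.2 hv₁
  have h2 := congrArg norm (φ.preGNS_norm_sq (φ.toPreGNS (1 - v)))
  rw [← Complex.ofReal_pow, Complex.norm_real, Real.norm_of_nonneg (sq_nonneg _),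
    φ.ofPreGNS_toPreGNS, (IsSelfAdjoint.of_nonneg hs).star_eq] at h2
  rw [h2]
  refine CStarAlgebra.norm_le_norm_of_nonneg_of_le
    (φ.map_nonneg ((IsSelfAdjoint.of_nonneg hs).mul_self_nonneg)) (OrderHomClass.mono φ ?_)
  have h3 := CStarAlgebra.pow_antitone hs (sub_le_self 1 hv₀) one_le_two
  simpa [sq] using h3

include hU₁ hUx in
/-- In the GNS space, `v` tends strongly to the projection onto the cyclic vector. -/
theorem tendsto_toPreGNS_mul_sub (hφ : φ 1 = 1) (z : A) :
    Tendsto (fun v => ‖φ.toPreGNS (v * z - φ z • 1)‖) U (𝓝 0) := by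
  have h1 := tendsto_toPreGNS_one_sub hU hU₁
  have h2 : Tendsto (fun v => ‖z‖ * ‖φ.toPreGNS (1 - v)‖ + ‖v * z * v - φ z • (v * v)‖ +
      ‖φ z‖ * (2 * ‖φ.toPreGNS (1 - v)‖)) U (𝓝 0) := by
    simpa using ((h1.const_mul ‖z‖).add (hUx z).norm).add ((h1.const_mul 2).const_mul ‖φ z‖)
  refine squeeze_zero' (.of_forall fun v => norm_nonneg _) ?_ h2
  filter_upwards [eventually_norm_le_one hU] with v hv
  have h3 : v * z - φ z • 1 = (v * z) * (1 - v) + (v * z * v - φ z • (v * v)) -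
      φ z • ((1 + v) * (1 - v)) := by
    simp only [mul_sub, add_mul, mul_one, one_mul, smul_sub, smul_add]
    abel
  rw [h3, map_sub, map_add, map_smul]
  refine (norm_sub_le _ _).trans (add_le_add ((norm_add_le _ _).trans (add_le_add ?_
    (norm_toPreGNS_le hφ _))) ?_)
  · refine (norm_toPreGNS_mul_le _ _).trans ?_
    gcongr
    exact (norm_mul_le _ _).trans (mul_le_of_le_one_left (norm_nonneg _) hv)
  · rw [norm_smul]
    gcongr
    refine (norm_toPreGNS_mul_le _ _).trans ?_
    gcongr
    refine (norm_add_le _ _).trans ?_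
    linarith [norm_one_le_one (A := A)]

variable {e : CStarBidual A} (he : ∀ f : StrongDual ℂ A, Tendsto (fun v => f v) U (𝓝 (e f)))
include he

theorem star_eq_of_tendsto : star e = e := by
  ext f
  refine tendsto_nhds_unique ?_ (he f)
  refine ((continuous_star.tendsto _).comp (he (dualStar A f))).congr' ?_
  filter_upwards [hU] with v hv
  simp [(IsSelfAdjoint.of_nonneg hv.1).star_eq]

include hUx in
/-- The functional `e · f` is bounded for the GNS seminorm of `φ`, as
`‖x v‖² = ‖v x⋆ x v‖` is close to `φ (x⋆ x) ‖v‖²`. -/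
theorem norm_bidualAct_le (f : StrongDual ℂ A) (x : A) :
    ‖bidualAct e f x‖ ≤ ‖f‖ * ‖φ.toPreGNS x‖ := by
  have h0 := hUx (star x * x)
  have hlim : Tendsto (fun v => ‖f‖ * √(‖v * (star x * x) * v - φ (star x * x) • (v * v)‖ +
      ‖φ (star x * x)‖)) U (𝓝 (‖f‖ * ‖φ.toPreGNS x‖)) := by
    have h2 := congrArg norm (φ.preGNS_norm_sq (φ.toPreGNS x))
    rw [← Complex.ofReal_pow, Complex.norm_real, Real.norm_of_nonneg (sq_nonneg _),
      φ.ofPreGNS_toPreGNS] at h2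
    have h3 := ((h0.norm.add_const ‖φ (star x * x)‖).sqrt).const_mul ‖f‖
    rw [norm_zero, zero_add] at h3
    nth_rw 2 [← h2] at h3
    rwa [Real.sqrt_sq (norm_nonneg _)] at h3
  refine le_of_tendsto_of_tendsto (he (dualMul f x)).norm hlim ?_
  filter_upwards [hU, eventually_norm_le_one hU] with v hv hv₁
  refine (f.le_opNorm (x * v)).trans ?_
  gcongr
  refine Real.le_sqrt_of_sq_le ?_
  rw [sq, ← CStarRing.norm_star_mul_self, star_mul, (IsSelfAdjoint.of_nonneg hv.1).star_eq]
  have h4 : v * star x * (x * v) = (v * (star x * x) * v - φ (star x * x) • (v * v)) +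
      φ (star x * x) • (v * v) := by
    rw [sub_add_cancel]; simp only [mul_assoc]
  rw [h4]
  refine (norm_add_le _ _).trans ?_
  gcongr
  rw [norm_smul]
  exact mul_le_of_le_one_right (norm_nonneg _) ((norm_mul_le _ _).trans
    (mul_le_one₀ hv₁ (norm_nonneg _) hv₁))

include hU₁ hUx in
/-- With `g = e · f`, the functionals `b ↦ g (v b)` converge in norm to `e f • φ`. -/
theorem tendsto_dualMul_bidualAct (hφ : φ 1 = 1) (f : StrongDual ℂ A) :
    Tendsto (fun v => dualMul (bidualAct e f) v) U (𝓝 (e f • toDual φ)) := by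
  set g := bidualAct e f with hg
  have hg1 : g 1 = e f := by
    rw [hg, bidualAct_apply]; congr 1; ext b; simp
  rw [← hg1, tendsto_iff_norm_sub_tendsto_zero, Metric.tendsto_nhds]
  intro ε hε
  obtain ⟨z, hz⟩ := exists_approx_of_bound φ g.toLinearMap
    (norm_bidualAct_le hU hUx he f) (ε := ε / 4) (by positivity)
  have hφ1 : ‖φ.toPreGNS 1‖ ≤ 1 := (norm_toPreGNS_le hφ 1).trans norm_one_le_one
  filter_upwards [hU, eventually_norm_le_one hU,
    (tendsto_toPreGNS_mul_sub hU hU₁ hUx hφ z).eventually (gt_mem_nhds (show 0 < ε / 4 by positivity))] with v hv hv₁ hvz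
  rw [dist_zero_right, norm_norm]
  have hle : ‖dualMul g v - g 1 • toDual φ‖ ≤ 3 * (ε / 4) := by
    refine ContinuousLinearMap.opNorm_le_bound _ (by positivity) fun b => ?_
    have hb := norm_toPreGNS_le hφ b
    have h1 : ‖g (v * b) - φ (star z * (v * b))‖ ≤ ε / 4 * ‖b‖ := by
      refine (hz (v * b)).trans ?_
      gcongr
      refine (norm_toPreGNS_le hφ _).trans ((norm_mul_le _ _).trans ?_)
      exact mul_le_of_le_one_left (norm_nonneg _) hv₁
    have h2 : ‖φ (star (v * z - φ z • 1) * b)‖ ≤ ε / 4 * ‖b‖ :=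
      (norm_apply_star_mul_le _ _).trans (mul_le_mul hvz.le hb (norm_nonneg _) (by positivity))
    have h3 : ‖(g 1 - φ (star z * 1)) * φ b‖ ≤ ε / 4 * ‖b‖ := by
      rw [norm_mul]
      refine mul_le_mul ((hz 1).trans (mul_le_of_le_one_right (by positivity) hφ1)) ?_
        (norm_nonneg _) (by positivity)
      have := norm_apply_star_mul_le (φ := φ) 1 b
      rw [star_one, one_mul] at this
      exact this.trans ((mul_le_of_le_one_left (norm_nonneg _) hφ1).trans hb)
    have h4 : (dualMul g v - g 1 • toDual φ) b = (g (v * b) - φ (star z * (v * b))) +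
        φ (star (v * z - φ z • 1) * b) - (g 1 - φ (star z * 1)) * φ b := by
      simp only [sub_apply, _root_.smul_apply, dualMul_apply,
        toDual_apply, smul_eq_mul, star_sub, star_mul, star_smul, star_one,
        (IsSelfAdjoint.of_nonneg hv.1).star_eq, sub_mul, smul_mul_assoc, one_mul, map_sub,
        map_smul, mul_one, map_star, mul_assoc]
      ring
    rw [h4]
    refine (norm_sub_le _ _).trans ((add_le_add (norm_add_le _ _) le_rfl).trans ?_)
    linarith
  linarith

include hU₁ hUx in
/-- The corner of `e` is one dimensional. Norm convergence in `tendsto_dualMul_bidualAct` is what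
allows an arbitrary `F` in the bidual: the Arens product is not visibly weak-⋆ continuous in its
right factor. -/
theorem mul_mul_eq_smul (hφ : φ 1 = 1) (F : CStarBidual A) : e * F * e = F (toDual φ) • e := by
  ext f
  rw [mul_assoc, mul_apply, smul_apply]
  have h1 : bidualAct (F * e) f = bidualAct F (bidualAct e f) := by
    ext a
    simp only [bidualAct_apply, mul_apply]
    congr 1
    ext b
    simp only [bidualAct_apply, dualMul_apply]
    congr 1
    ext c
    simp [mul_assoc]
  rw [h1]
  refine tendsto_nhds_unique (he _) ?_
  have hF : Continuous (fun f => F f) :=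
    ContinuousLinearMap.continuous (show StrongDual ℂ (StrongDual ℂ A) from F)
  have h2 := (hF.tendsto _).comp (tendsto_dualMul_bidualAct hU hU₁ hUx he hφ f)
  rw [map_smul_dual, mul_comm] at h2
  exact h2

end Ultrafilter

/-- Every pure state `φ` takes the value `1` on some minimal projection `e` of the bidual, namely
on the weak-⋆ limit of positive contractions that excise `φ`; the corner of `e` is given by
`e F e = F(φ) e`. -/
theorem exists_isMinimalProjection {L : selfAdjoint A →ₗ[ℝ] ℝ} (hL : IsPureState 1 L) :
    ∃ e : CStarBidual A, IsMinimalProjection e ∧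
      e (toDual (positiveExtend L hL.nonneg)) = 1 ∧
      ∀ F : CStarBidual A, e * F * e = F (toDual (positiveExtend L hL.nonneg)) • e := by
  obtain ⟨U, hU, hU₁, hUx⟩ := hL.exists_ultrafilter
  obtain ⟨e, he⟩ := exists_ultrafilter_lim (eventually_norm_le_one hU)
  have hφ : positiveExtend L hL.nonneg 1 = 1 := by
    have := positiveExtend_coe hL.nonneg 1
    rw [hL.map_unit] at this
    exact_mod_cast this
  have hmul := mul_mul_eq_smul hU hU₁ hUx he hφ
  have he1 : e (toDual (positiveExtend L hL.nonneg)) = 1 := by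
    refine tendsto_nhds_unique (he _) ?_
    have := hU₁.const_sub 1
    simpa [hφ] using this
  have he0 : e ≠ 0 := by rintro rfl; simp at he1
  refine ⟨e, ⟨⟨?_, star_eq_of_tendsto hU he⟩, ?_⟩, he1, hmul⟩
  · have := hmul (incl A 1)
    rwa [mul_incl_one, incl_apply, toDual_apply, hφ, one_smul] at this
  · have hrange : LinearMap.range (LinearMap.mulLeftRight ℂ (e, e)) = ℂ ∙ e := by
      refine le_antisymm ?_ ?_
      · rintro _ ⟨F, rfl⟩
        rw [LinearMap.mulLeftRight_apply, hmul]
        exact Submodule.smul_mem _ _ (Submodule.mem_span_singleton_self e)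
      · rw [Submodule.span_singleton_le_iff_mem]
        refine ⟨incl A 1, ?_⟩
        rw [LinearMap.mulLeftRight_apply, hmul, incl_apply, toDual_apply, hφ, one_smul]
    rw [hrange, finrank_span_singleton he0]

end CStarBidual

/-! ### Projections with one dimensional corners and finite dimensionality -/

section Finite

variable {A : Type*} [CStarAlgebra A]

/-- The self-adjoint idempotents `p` of `A` with `p A p ⊆ ℂ p`: the minimal projections of `A`,
together with `0`. -/
def scalarCornerProjections (A : Type*) [CStarAlgebra A] : Set (selfAdjoint A) :=
  {p | (p * p : A) = p ∧ ∀ x : A, ∃ c : ℂ, (p * x * p : A) = c • (p : A)}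

theorem finiteDimensional_range_mulLeftRight {p q : selfAdjoint A}
    (hp : p ∈ scalarCornerProjections A) (hq : q ∈ scalarCornerProjections A) :
    FiniteDimensional ℂ (LinearMap.range (LinearMap.mulLeftRight ℂ ((p : A), (q : A)))) := by
  by_cases h : ∀ x : A, (p * x * q : A) = 0
  · have : LinearMap.mulLeftRight ℂ ((p : A), (q : A)) = 0 := by
      ext x; simpa using h x
    rw [this, LinearMap.range_zero]
    infer_instance
  push Not at h
  obtain ⟨x, hx⟩ := h
  have hps : star (p : A) = p := p.2.star_eq
  have hqs : star (q : A) = q := q.2.star_eq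
  -- `(p x q) (p x q)⋆ = c p` with `c ≠ 0`
  obtain ⟨c, hc⟩ := hp.2 (x * q * star x)
  have hc' : (p * x * q : A) * star (p * x * q : A) = c • (p : A) := by
    rw [← hc, star_mul, star_mul, hps, hqs]
    calc (p * x * q * (q * (star x * p)) : A) = p * x * (q * q) * star x * p := by
          simp only [mul_assoc]
      _ = _ := by rw [hq.1]; simp only [mul_assoc]
  have hc0 : c ≠ 0 := by
    rintro rfl
    rw [zero_smul, CStarRing.mul_star_self_eq_zero_iff] at hc'
    exact hx hc'
  refine Submodule.finiteDimensional_of_le (S₂ := ℂ ∙ (p * x * q : A)) ?_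
  rintro _ ⟨y, rfl⟩
  obtain ⟨d, hd⟩ := hq.2 (star x * p * y)
  rw [LinearMap.mulLeftRight_apply, Submodule.mem_span_singleton]
  refine ⟨c⁻¹ * d, ?_⟩
  have h1 : c • (p * y * q : A) = d • (p * x * q : A) := by
    calc c • (p * y * q : A) = c • (p : A) * (y * q) := by rw [smul_mul_assoc, mul_assoc]
      _ = p * x * (q * q) * star x * (p * p) * y * q := by
          rw [← hc', star_mul, star_mul, hps, hqs, hp.1]; simp only [mul_assoc]
      _ = p * x * q * (q * (star x * p * y) * q) := by
          rw [hp.1]; simp only [mul_assoc]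
      _ = d • (p * x * q : A) := by rw [hd, mul_smul_comm, mul_assoc _ (q : A), hq.1]
  rw [mul_smul, ← h1, smul_smul, inv_mul_cancel₀ hc0, one_smul]

/-- `A` is finite dimensional if some invertible element `z` lies in the linear span of the
projections with one dimensional corners: `x ↦ z x z` embeds `A` into the sum of finitely many
subspaces `p A q`. -/
theorem finiteDimensional_of_isUnit_mem_span {z : A} (hz : IsUnit z)
    (hzs : z ∈ Submodule.span ℂ ((↑) '' scalarCornerProjections A : Set A)) :
    FiniteDimensional ℂ A := by
  obtain ⟨T, hT, hzT⟩ := Submodule.mem_span_finite_of_mem_span hzs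
  let W : Submodule ℂ A :=
    ⨆ r : T × T, LinearMap.range (LinearMap.mulLeftRight ℂ ((r.1 : A), (r.2 : A)))
  have hfin : ∀ r : T × T, FiniteDimensional ℂ
      (LinearMap.range (LinearMap.mulLeftRight ℂ ((r.1 : A), (r.2 : A)))) := by
    rintro ⟨⟨p, hp⟩, ⟨q, hq⟩⟩
    obtain ⟨p', hp', rfl⟩ := hT hp
    obtain ⟨q', hq', rfl⟩ := hT hq
    exact finiteDimensional_range_mulLeftRight hp' hq'
  have hW : FiniteDimensional ℂ W := Submodule.finiteDimensional_iSup _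
  have hmem : ∀ x, z * x * z ∈ W := fun x => by
    have key : ∀ w ∈ Submodule.span ℂ (T : Set A), ∀ w' ∈ Submodule.span ℂ (T : Set A),
        w * x * w' ∈ W := by
      intro w hw w' hw'
      induction hw, hw' using Submodule.span_induction₂ with
      | mem_mem p q hp hq =>
        exact Submodule.mem_iSup_of_mem (⟨⟨p, hp⟩, ⟨q, hq⟩⟩ : T × T) ⟨x, rfl⟩
      | zero_left q hq => simp
      | zero_right p hp => simp
      | add_left a b q _ _ _ ha hb => rw [add_mul, add_mul]; exact W.add_mem ha hb
      | add_right p a b _ _ _ ha hb => rw [mul_add]; exact W.add_mem ha hb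
      | smul_left r a b _ _ h => rw [smul_mul_assoc, smul_mul_assoc]; exact W.smul_mem r h
      | smul_right r a b _ _ h => rw [mul_smul_comm]; exact W.smul_mem r h
    exact key z hzT z hzT
  refine FiniteDimensional.of_injective
    ((LinearMap.mulLeftRight ℂ (z, z)).codRestrict W hmem) fun x y hxy => ?_
  have h1 : z * x * z = z * y * z := congrArg Subtype.val hxy
  exact hz.mul_left_cancel (hz.mul_right_cancel h1)

variable [PartialOrder A] [StarOrderedRing A]

theorem scalarCornerProjections_nonneg {p : selfAdjoint A} (hp : p ∈ scalarCornerProjections A) :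
    0 ≤ p := by
  change (0 : A) ≤ p
  rw [← hp.1]
  exact IsSelfAdjoint.mul_self_nonneg p.2

/-- If every pure state is nonzero on some projection with one dimensional corner, then `A` is
finite dimensional. -/
theorem finiteDimensional_of_isPureState
    (h : ∀ L : selfAdjoint A →ₗ[ℝ] ℝ, IsPureState 1 L →
      ∃ p ∈ scalarCornerProjections A, L p ≠ 0) : FiniteDimensional ℂ A := by
  have := selfAdjoint.posSMulMono (A := A)
  let Z : PointedCone ℝ (selfAdjoint A) := PointedCone.hull ℝ (scalarCornerProjections A)
  have hsub : scalarCornerProjections A ⊆ Z := Submodule.subset_span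
  have hZ : ∀ z ∈ Z, 0 ≤ z := by
    intro z hz
    induction hz using Submodule.span_induction with
    | mem p hp => exact scalarCornerProjections_nonneg hp
    | zero => exact le_rfl
    | add a b _ _ ha hb => exact add_nonneg ha hb
    | smul r a _ ha => exact smul_nonneg (a := (r : ℝ)) r.2 ha
  by_cases hu : ∃ z ∈ Z, 1 ≤ z
  · obtain ⟨z, hz, h1z⟩ := hu
    refine finiteDimensional_of_isUnit_mem_span (z := (z : A)) ?_ ?_
    · exact CStarAlgebra.isUnit_of_le (1 : A) h1z
    · clear h1z
      induction hz using Submodule.span_induction with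
      | mem p hp => exact Submodule.subset_span ⟨p, hp, rfl⟩
      | zero => exact Submodule.zero_mem _
      | add a b _ _ ha hb => exact Submodule.add_mem _ ha hb
      | smul r a _ ha =>
        have := Submodule.smul_mem _ ((r : ℝ) : ℂ) ha
        rwa [Complex.coe_smul] at this
  · push Not at hu
    obtain ⟨L₀, h₀, h₀u, h₀Z⟩ := exists_state_of_not_le selfAdjoint.exists_le_smul_one Z hZ hu
    obtain ⟨L, hL, hLZ⟩ := exists_isPureState_of_state selfAdjoint.zero_le_one
      selfAdjoint.exists_le_smul_one hZ h₀ h₀u h₀Z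
    obtain ⟨p, hp, hLp⟩ := h L hL
    exact absurd (hLZ p (hsub hp)) hLp

end Finite

/-- A finite dimensional space is reflexive. -/
theorem CStarBidual.incl_surjective_of_finiteDimensional {A : Type*} [CStarAlgebra A]
    [FiniteDimensional ℂ A] : Function.Surjective (CStarBidual.incl A) := by
  intro F
  let F' : Module.Dual ℂ (Module.Dual ℂ A) :=
    (show StrongDual ℂ (StrongDual ℂ A) from F).toLinearMap ∘ₗ
      (LinearMap.toContinuousLinearMap (𝕜 := ℂ) (E := A) (F' := ℂ)).toLinearMap
  obtain ⟨a, ha⟩ := (Module.evalEquiv ℂ A).surjective F'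
  refine ⟨a, CStarBidual.ext fun f => ?_⟩
  have h := LinearMap.congr_fun ha f.toLinearMap
  exact h

theorem corollary2p4 {A : Type*} [CStarAlgebra A] :
    FiniteDimensional ℂ A ↔
      ∀ e : CStarBidual A, IsMinimalProjection e → ∃ a : A, CStarBidual.incl A a = e := by
  refine ⟨fun _ e _ => CStarBidual.incl_surjective_of_finiteDimensional e, fun h => ?_⟩
  let _ := CStarAlgebra.spectralOrder A
  have := CStarAlgebra.spectralOrderedRing A
  refine finiteDimensional_of_isPureState fun L hL => ?_
  obtain ⟨e, he, heL, hmul⟩ := CStarBidual.exists_isMinimalProjection hL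
  obtain ⟨p, rfl⟩ := h e he
  have hsa : star p = p := CStarBidual.incl_injective <| by
    rw [CStarBidual.incl_star]; exact he.1.2
  refine ⟨⟨p, hsa⟩, ⟨CStarBidual.incl_injective ?_, fun x =>
    ⟨positiveExtend L hL.nonneg x, CStarBidual.incl_injective ?_⟩⟩, fun h0 => ?_⟩
  · rw [CStarBidual.incl_mul]; exact he.1.1
  · rw [CStarBidual.incl_mul, CStarBidual.incl_mul, hmul, map_smul]
    rfl
  · rw [CStarBidual.incl_apply, CStarBidual.toDual_apply] at heL
    have h1 := positiveExtend_coe hL.nonneg ⟨p, hsa⟩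
    rw [h0] at h1
    simp [heL] at h1
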